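/- Let $K$ be a field and let $S$ be an affine semigroup, i.e. a finitely generated monoid isomorphic to a submonoid of some $\mathbb{Z}^n$; fix such an isomorphism and regard $S$ as a submonoid of $\mathbb{Z}^n\subseteq\mathbb{R}^n$. For $T\subseteq\mathbb{Z}^n$ let $\mathrm{grp}(T)$ be the subgroup of $\mathbb{Z}^n$ generated by $T$. Let $\mathbb{R}S$ be the real vector subspace of $\mathbb{R}^n$ spanned by $S$, and let $C=\mathrm{pos}(S)\subseteq\mathbb{R}S$ be the cone of all nonnegative real linear combinations of elements of $S$. A facet of $C$ is a set $F=C\cap\{\varphi=0\}$, where $\varphi$ is a real linear form that is nonnegative on $C$, such that the linear span of $F$ has dimension $\dim\mathbb{R}S-1$. For a facet $F$, let $\sigma_F:\mathbb{R}S\to\mathbb{R}$ be the corresponding primitive linear form: the unique linear form that is nonnegative on $C$, satisfies $F=C\cap\{\sigma_F=0\}$, and is integral and primitive with respect to the lattice $\mathrm{grp}(S)$, i.e. $\sigma_F(\mathrm{grp}(S))=\mathbb{Z}$. Put $H_F=\{\alpha\in\mathbb{R}S\mid\sigma_F(\alpha)=0\}$. Then the monoid ring $K[S]$ satisfies Serre's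 condition $\mathrm{R}_1$ (that is, $K[S]_P$ is a regular local ring for every prime ideal $P$ of height at most $1$) if and only if the following two conditions hold for every facet $F$ of $C$: (i) there exists an element $\beta\in S$ such that $\sigma_F(\beta)=1$; (ii) $\mathrm{grp}(S\cap F)=\mathrm{grp}(S)\cap H_F$. -/

import Mathlib

/-- Serre's condition `R_k`: the localization at every prime of height at most `k` is regular. -/
def SatisfiesSerreR (k : ℕ) (R : Type*) [CommRing R] : Prop :=
  ∀ (P : Ideal R) [P.IsPrime], P.height ≤ (k : ℕ∞) → IsRegularLocalRing (Localization.AtPrime P)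

namespace AffineSemigroup

variable {n : ℕ}

/-- The inclusion `ℤⁿ ⊆ ℝⁿ`. -/
def toReal (n : ℕ) : (Fin n → ℤ) →+ (Fin n → ℝ) :=
  (Int.castAddHom ℝ).compLeft (Fin n)

/-- `grp(T)`, the subgroup of `ℤⁿ` generated by `T`. -/
def grp (T : Set (Fin n → ℤ)) : AddSubgroup (Fin n → ℤ) := AddSubgroup.closure T

/-- `pos(S)`, the cone in `ℝⁿ` of all nonnegative real linear combinations of elements of `S`. -/
noncomputable def pos (S : AddSubmonoid (Fin n → ℤ)) : PointedCone ℝ (Fin n → ℝ) :=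
  PointedCone.hull ℝ (toReal n '' (S : Set (Fin n → ℤ)))

/-- `ℝS`, the real vector subspace of `ℝⁿ` spanned by `S`. -/
def realSpan (S : AddSubmonoid (Fin n → ℤ)) : Submodule ℝ (Fin n → ℝ) :=
  Submodule.span ℝ (toReal n '' (S : Set (Fin n → ℤ)))

/-- `F` is a facet of the cone `C`: the intersection of `C` with a supporting hyperplane
`φ = 0` (where `φ ≥ 0` on `C`), of dimension one less than `C`. -/
def IsFacet (C : PointedCone ℝ (Fin n → ℝ)) (F : Set (Fin n → ℝ)) : Prop :=
  ∃ φ : (Fin n → ℝ) →ₗ[ℝ] ℝ, (∀ x ∈ C, 0 ≤ φ x) ∧ F = {x | x ∈ C ∧ φ x = 0} ∧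
    Module.finrank ℝ (Submodule.span ℝ F) + 1 =
      Module.finrank ℝ (Submodule.span ℝ (C : Set (Fin n → ℝ)))

/-- `σ` is the primitive integral linear form on `ℝS` that cuts out `F` from `pos(S)`.
Integrality and primitivity refer to the lattice `grp(S)` of `ℝS`: the coefficients of `σ` in a
basis of `grp(S)` are relatively prime integers if and only if `σ(grp(S)) = ℤ`. -/
structure IsPrimitiveForm (S : AddSubmonoid (Fin n → ℤ)) (F : Set (Fin n → ℝ))
    (σ : realSpan S →ₗ[ℝ] ℝ) : Prop where
  nonneg : ∀ x : realSpan S, (x : Fin n → ℝ) ∈ pos S → 0 ≤ σ x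
  zero_iff : ∀ x : realSpan S, (x : Fin n → ℝ) ∈ pos S → (σ x = 0 ↔ (x : Fin n → ℝ) ∈ F)
  primitive : {r : ℝ | ∃ x : realSpan S, (∃ α ∈ grp (S : Set (Fin n → ℤ)), toReal n α = x) ∧
    σ x = r} = Set.range ((↑) : ℤ → ℝ)

/-- The inclusion `S ⊆ ℝS`. -/
def incl (S : AddSubmonoid (Fin n → ℤ)) (β : S) : realSpan S :=
  ⟨toReal n β, Submodule.subset_span ⟨β, β.2, rfl⟩⟩

lemma span_pos (S : AddSubmonoid (Fin n → ℤ)) :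
    Submodule.span ℝ (pos S : Set (Fin n → ℝ)) = realSpan S := by
  apply le_antisymm
  · rw [Submodule.span_le]
    exact fun x hx => PointedCone.hull_le_span ℝ _ hx
  · exact Submodule.span_mono PointedCone.subset_hull

lemma IsFacet.subset_realSpan {S : AddSubmonoid (Fin n → ℤ)} {F : Set (Fin n → ℝ)}
    (hF : IsFacet (pos S) F) : Submodule.span ℝ F ≤ realSpan S := by
  obtain ⟨φ, -, rfl, -⟩ := hF
  rw [← span_pos]
  exact Submodule.span_mono fun x hx => hx.1

lemma IsFacet.ker_eq {S : AddSubmonoid (Fin n → ℤ)} {F : Set (Fin n → ℝ)}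
    (hF : IsFacet (pos S) F) (σ : realSpan S →ₗ[ℝ] ℝ) (h0 : σ ≠ 0)
    (hσ : ∀ x : realSpan S, (x : Fin n → ℝ) ∈ F → σ x = 0) :
    LinearMap.ker σ = (Submodule.span ℝ F).comap (realSpan S).subtype := by
  symm
  have hle : (Submodule.span ℝ F).comap (realSpan S).subtype ≤ LinearMap.ker σ := by
    rw [← Submodule.map_le_map_iff_of_injective (realSpan S).subtype_injective,
      Submodule.map_comap_subtype, inf_eq_right.2 hF.subset_realSpan, Submodule.span_le]
    intro x hx
    exact ⟨⟨x, hF.subset_realSpan (Submodule.subset_span hx)⟩, hσ _ hx, rfl⟩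
  apply Submodule.eq_of_le_of_finrank_eq hle
  have h1 : Module.finrank ℝ ((Submodule.span ℝ F).comap (realSpan S).subtype) =
      Module.finrank ℝ (Submodule.span ℝ F) :=
    (Submodule.comapSubtypeEquivOfLe hF.subset_realSpan).finrank_eq
  have h2 := LinearMap.finrank_range_add_finrank_ker σ
  rw [LinearMap.range_eq_top.2 (LinearMap.surjective h0), finrank_top, Module.finrank_self] at h2
  obtain ⟨φ, -, -, h3⟩ := hF
  rw [span_pos] at h3
  omega

lemma exists_mem_pos_ne_zero {S : AddSubmonoid (Fin n → ℤ)} (σ : realSpan S →ₗ[ℝ] ℝ)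
    (h0 : σ ≠ 0) : ∃ x : realSpan S, (x : Fin n → ℝ) ∈ pos S ∧ σ x ≠ 0 := by
  by_contra! h
  apply h0
  have : realSpan S ≤ (LinearMap.ker σ).map (realSpan S).subtype := by
    conv_lhs => rw [← span_pos]
    rw [Submodule.span_le]
    intro x hx
    exact ⟨⟨x, by rw [← span_pos]; exact Submodule.subset_span hx⟩, h _ hx, rfl⟩
  ext x
  obtain ⟨y, hy, hxy⟩ := this x.2
  obtain rfl : y = x := Subtype.ext hxy
  exact hy

lemma IsPrimitiveForm.ne_zero {S : AddSubmonoid (Fin n → ℤ)} {F : Set (Fin n → ℝ)}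
    {σ : realSpan S →ₗ[ℝ] ℝ} (h : IsPrimitiveForm S F σ) : σ ≠ 0 := by
  rintro rfl
  have : (1 : ℝ) ∈ Set.range ((↑) : ℤ → ℝ) := ⟨1, by simp⟩
  rw [← h.primitive] at this
  obtain ⟨x, -, hx⟩ := this
  simp at hx

lemma IsPrimitiveForm.unique {S : AddSubmonoid (Fin n → ℤ)} {F : Set (Fin n → ℝ)}
    (hF : IsFacet (pos S) F) {σ τ : realSpan S →ₗ[ℝ] ℝ} (hσ : IsPrimitiveForm S F σ)
    (hτ : IsPrimitiveForm S F τ) : σ = τ := by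
  have hFpos : ∀ x ∈ F, x ∈ pos S := by
    obtain ⟨φ, -, rfl, -⟩ := hF
    exact fun x hx => hx.1
  have hk : LinearMap.ker σ = LinearMap.ker τ := by
    rw [hF.ker_eq σ hσ.ne_zero fun x hx => (hσ.zero_iff x (hFpos _ hx)).2 hx,
      hF.ker_eq τ hτ.ne_zero fun x hx => (hτ.zero_iff x (hFpos _ hx)).2 hx]
  have h1 : (1 : ℝ) ∈ Set.range ((↑) : ℤ → ℝ) := ⟨1, by simp⟩
  have h1' := h1
  rw [← hσ.primitive] at h1
  obtain ⟨x₀, hx₀, hx₀1⟩ := h1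
  have key : ∀ y, τ y = σ y * τ x₀ := by
    intro y
    have : y - σ y • x₀ ∈ LinearMap.ker σ := by simp [hx₀1]
    rw [hk, LinearMap.mem_ker, map_sub, map_smul, smul_eq_mul] at this
    linarith
  obtain ⟨t, ht⟩ : τ x₀ ∈ Set.range ((↑) : ℤ → ℝ) := by
    rw [← hτ.primitive]; exact ⟨x₀, hx₀, rfl⟩
  rw [← hτ.primitive] at h1'
  obtain ⟨y, hy, hy1⟩ := h1'
  obtain ⟨s, hs⟩ : σ y ∈ Set.range ((↑) : ℤ → ℝ) := by
    rw [← hσ.primitive]; exact ⟨y, hy, rfl⟩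
  rw [key, ← hs, ← ht] at hy1
  have hst : s * t = 1 := by exact_mod_cast hy1
  obtain ⟨z, hz, hz0⟩ := exists_mem_pos_ne_zero σ hσ.ne_zero
  have hz1 : 0 < σ z := lt_of_le_of_ne (hσ.nonneg z hz) (Ne.symm hz0)
  have hz2 := hτ.nonneg z hz
  rw [key] at hz2
  have ht0 : (0 : ℝ) ≤ t := by rw [ht]; exact nonneg_of_mul_nonneg_right hz2 hz1
  have ht1 : t = 1 := by
    have : (0:ℤ) ≤ t := by exact_mod_cast ht0
    exact Int.eq_one_of_dvd_one this ⟨s, by rw [mul_comm]; exact hst.symm⟩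
  ext y
  rw [key, ← ht, ht1]; simp

lemma IsFacet.le_span {S : AddSubmonoid (Fin n → ℤ)} {F : Set (Fin n → ℝ)}
    (hF : IsFacet (pos S) F) :
    F ⊆ Submodule.span ℝ {x | x ∈ toReal n '' (S : Set (Fin n → ℤ)) ∧ x ∈ F} := by
  obtain ⟨φ, hφ, rfl, -⟩ := hF
  rintro x ⟨hx, hx0⟩
  obtain ⟨c, hc, hc0, rfl⟩ := PointedCone.mem_hull_set.1 hx
  have hmem : ∀ y ∈ c.support, y ∈ pos S := fun y hy => PointedCone.subset_hull (hc hy)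
  rw [Finsupp.sum, map_sum, Finset.sum_eq_zero_iff_of_nonneg] at hx0
  · refine Submodule.sum_mem _ fun y hy => Submodule.smul_mem _ _ (Submodule.subset_span ?_)
    refine ⟨hc hy, hmem y hy, ?_⟩
    have := hx0 y hy
    rw [map_smul, smul_eq_mul] at this
    exact (mul_eq_zero.1 this).resolve_left (Finsupp.mem_support_iff.1 hy)
  · intro y hy
    rw [map_smul]
    exact mul_nonneg (hc0 y) (hφ y (hmem y hy))

/-- The group `grp(S)` inside `ℝⁿ`. -/
def latt (S : AddSubmonoid (Fin n → ℤ)) : Submodule ℤ (Fin n → ℝ) :=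
  Submodule.span ℤ (toReal n '' (S : Set (Fin n → ℤ)))

lemma mem_latt {S : AddSubmonoid (Fin n → ℤ)} {x : Fin n → ℝ} :
    x ∈ latt S ↔ ∃ α ∈ grp (S : Set (Fin n → ℤ)), toReal n α = x := by
  rw [latt, ← Submodule.mem_toAddSubgroup, Submodule.span_int_eq_addSubgroupClosure,
    ← AddMonoidHom.map_closure]
  rfl

lemma toReal_mem (α : Fin n → ℤ) :
    toReal n α ∈ Submodule.span ℤ (Set.range (Pi.basisFun ℝ (Fin n))) := by
  rw [Module.Basis.mem_span_iff_repr_mem ℤ (Pi.basisFun ℝ (Fin n))]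
  intro i
  exact ⟨α i, by simp [toReal]⟩

lemma latt_le (S : AddSubmonoid (Fin n → ℤ)) :
    latt S ≤ Submodule.span ℤ (Set.range (Pi.basisFun ℝ (Fin n))) := by
  rw [latt, Submodule.span_le]
  rintro _ ⟨α, -, rfl⟩
  exact toReal_mem α

lemma finrank_span_of_le {L : Submodule ℤ (Fin n → ℝ)}
    (hL : L ≤ Submodule.span ℤ (Set.range (Pi.basisFun ℝ (Fin n)))) :
    Module.finrank ℝ (Submodule.span ℝ (L : Set (Fin n → ℝ))) = Module.finrank ℤ L := by
  have hd : DiscreteTopology (Submodule.span ℤ (L : Set (Fin n → ℝ))) := by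
    rw [Submodule.span_eq]
    have h : DiscreteTopology (Submodule.span ℤ (Set.range (Pi.basisFun ℝ (Fin n)))) :=
      inferInstance
    exact DiscreteTopology.of_subset h hL
  have := Real.finrank_eq_int_finrank_of_discrete hd
  rw [Set.finrank, Set.finrank, Submodule.span_eq] at this
  exact this

lemma IsFacet.exists_isPrimitiveForm {S : AddSubmonoid (Fin n → ℤ)} {F : Set (Fin n → ℝ)}
    (hF : IsFacet (pos S) F) : ∃ σ, IsPrimitiveForm S F σ := by
  have hF' := hF
  obtain ⟨φ, hφ, hFφ, hdim⟩ := hF'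
  have hFpos : ∀ x ∈ F, x ∈ pos S := by rw [hFφ]; exact fun x hx => hx.1
  have hpos : ∀ x ∈ pos S, x ∈ realSpan S := fun x hx => by
    rw [← span_pos]; exact Submodule.subset_span hx
  set ψ : realSpan S →ₗ[ℝ] ℝ := φ.domRestrict (realSpan S) with hψ
  have hψ0 : ψ ≠ 0 := by
    intro h
    have : F = pos S := by
      rw [hFφ]; ext x
      refine ⟨fun h => h.1, fun hx => ⟨hx, ?_⟩⟩
      exact LinearMap.congr_fun h ⟨x, hpos x hx⟩
    rw [this] at hdim
    omega
  have hker := hF.ker_eq ψ hψ0 (fun x hx => by rw [hFφ] at hx; exact hx.2)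
  -- the lattice and its values under `φ`
  let f : latt S →ₗ[ℤ] ℝ := (φ.restrictScalars ℤ).domRestrict (latt S)
  have hfree : Module.Finite ℤ (latt S) := by
    have : IsNoetherian ℤ (Submodule.span ℤ (Set.range (Pi.basisFun ℝ (Fin n)))) :=
      isNoetherian_span_of_finite ℤ (Set.finite_range _)
    exact Module.Finite.of_injective (Submodule.inclusion (latt_le S))
      (Submodule.inclusion_injective _)
  have hspanL : Submodule.span ℝ (latt S : Set (Fin n → ℝ)) = realSpan S := by
    rw [latt, Submodule.span_span_of_tower]; rfl
  have hlatt : ∀ x ∈ latt S, x ∈ realSpan S := fun x hx => by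
    rw [← hspanL]; exact Submodule.subset_span hx
  have hrank1 : Module.finrank ℤ (latt S) = Module.finrank ℝ (realSpan S) := by
    rw [← finrank_span_of_le (latt_le S), hspanL]
  let L' : Submodule ℤ (Fin n → ℝ) := (LinearMap.ker f).map (latt S).subtype
  have hL' : L' ≤ latt S := Submodule.map_subtype_le _ _
  have hspanL' : Submodule.span ℝ (L' : Set (Fin n → ℝ)) = Submodule.span ℝ F := by
    apply le_antisymm
    · rw [Submodule.span_le]
      rintro _ ⟨x, hx, rfl⟩
      have : (⟨x, hlatt x x.2⟩ : realSpan S) ∈ LinearMap.ker ψ := hx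
      rw [hker] at this
      exact this
    · rw [Submodule.span_le]
      refine hF.le_span.trans (Submodule.span_mono ?_)
      rintro x ⟨hx, hxF⟩
      rw [hFφ] at hxF
      exact ⟨⟨x, Submodule.subset_span hx⟩, hxF.2, rfl⟩
  have hrank2 : Module.finrank ℤ (LinearMap.ker f) = Module.finrank ℝ (Submodule.span ℝ F) := by
    rw [← hspanL', finrank_span_of_le (hL'.trans (latt_le S))]
    exact (Submodule.equivMapOfInjective _ (latt S).subtype_injective _).finrank_eq
  have hrank3 : Module.finrank ℤ (LinearMap.range f) = 1 := by
    have h := Submodule.finrank_quotient_add_finrank (LinearMap.ker f)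
    rw [f.quotKerEquivRange.finrank_eq, hrank1, hrank2] at h
    rw [span_pos] at hdim
    omega
  obtain ⟨c, hc0, hc⟩ := finrank_eq_one_iff'.1 hrank3
  have hc0' : (c : ℝ) ≠ 0 := fun h => hc0 (Subtype.ext h)
  have habs : 0 < |(c : ℝ)| := abs_pos.2 hc0'
  refine ⟨|(c : ℝ)|⁻¹ • ψ, ?_, ?_, ?_⟩
  · intro x hx
    exact mul_nonneg (inv_nonneg.2 habs.le) (hφ x hx)
  · intro x hx
    rw [hFφ]
    simp [hψ, hc0', hx]
  · ext r
    simp only [Set.mem_ofPred_eq, ← mem_latt, Set.mem_range]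
    obtain ⟨ε, hε⟩ : ∃ ε : ℤ, ε * ε = 1 ∧ |(c : ℝ)|⁻¹ * c = ε := by
      rcases abs_choice (c : ℝ) with h | h
      · exact ⟨1, by simp, by rw [h]; simp [hc0']⟩
      · exact ⟨-1, by simp, by rw [h]; simp [hc0', inv_neg]⟩
    constructor
    · rintro ⟨x, hx, rfl⟩
      obtain ⟨m, hm⟩ := hc ⟨φ x, ⟨⟨x, hx⟩, rfl⟩⟩
      have hm : m • (c : ℝ) = φ x := congrArg Subtype.val hm
      refine ⟨m * ε, ?_⟩
      change _ = |(c : ℝ)|⁻¹ * φ x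
      rw [← hm, zsmul_eq_mul]
      push_cast
      rw [← hε.2]; ring
    · rintro ⟨m, rfl⟩
      obtain ⟨y, hy⟩ := c.2
      refine ⟨(m * ε) • ⟨y, hlatt y y.2⟩, (latt S).smul_mem (m * ε) y.2, ?_⟩
      rw [map_zsmul]
      change (m * ε) • (|(c : ℝ)|⁻¹ * φ y) = _
      have hy : φ y = c := hy
      have h1 : (ε : ℝ) * ε = 1 := by exact_mod_cast hε.1
      rw [hy, hε.2, zsmul_eq_mul]
      push_cast
      rw [mul_assoc, h1, mul_one]

theorem existsUnique_isPrimitiveForm {S : AddSubmonoid (Fin n → ℤ)} {F : Set (Fin n → ℝ)}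
    (hF : IsFacet (pos S) F) : ∃! σ, IsPrimitiveForm S F σ := by
  obtain ⟨σ, hσ⟩ := hF.exists_isPrimitiveForm
  exact ⟨σ, hσ, fun τ hτ => IsPrimitiveForm.unique hF hτ hσ⟩

/-- `σ_F`, the primitive linear form of the facet `F` of `pos(S)`. It exists and is unique, see
`existsUnique_isPrimitiveForm`. -/
noncomputable def facetForm (S : AddSubmonoid (Fin n → ℤ)) (F : Set (Fin n → ℝ)) :
    realSpan S →ₗ[ℝ] ℝ :=
  Classical.epsilon (IsPrimitiveForm S F)

theorem isPrimitiveForm_facetForm {S : AddSubmonoid (Fin n → ℤ)} {F : Set (Fin n → ℝ)}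
    (hF : IsFacet (pos S) F) : IsPrimitiveForm S F (facetForm S F) :=
  Classical.epsilon_spec hF.exists_isPrimitiveForm

/-- `H_F = {α ∈ ℝS | σ_F(α) = 0}`. -/
noncomputable def facetHyperplane (S : AddSubmonoid (Fin n → ℤ)) (F : Set (Fin n → ℝ)) :
    Set (Fin n → ℝ) :=
  {x | ∃ h : x ∈ realSpan S, facetForm S F ⟨x, h⟩ = 0}

end AffineSemigroup

/-!
A prime `P` of `K[S]` of height at most one either contains no monomial or is the prime of a facet.

In the first case `P` survives in the localization of `K[S]` at all monomials. This is the Laurent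
polynomial ring `K[grp(S)]`, a localization of a polynomial ring, hence a unique factorization
domain, in which primes of height one are principal. So `K[S]_P` is always regular
(`isRegularLocalRing_of_forall_single_notMem`).

In the second case, the exponents of the monomials outside of `P` form a proper face of `S`. By
Farkas' lemma such a face lies on a supporting hyperplane of the cone, and tilting the hyperplane
puts the face inside a facet `F` (`exists_isFacet_of_face`). The monomials off `F` span a nonzero
prime contained in `P`, hence equal to `P`. Conversely, the prime of a facet has height one by
Krull's principal ideal theorem (`height_posDegIdeal_le_one`).

It remains to decide when `K[S]` is regular at the prime `P` of a facet `F`, that is, when the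
maximal ideal of `K[S]_P` is principal. Grade `K[S]` by `d = σ_F`, so that `P` is spanned by the
monomials of positive degree. Then the maximal ideal is principal if and only if it is generated by
a monomial `χ^β`; comparing parts of lowest degree, this means that every `γ ∈ S` is a multiple of
`β` up to elements of `S ∩ F` (`isRegularLocalRing_posDegIdeal`,
`exists_of_isRegularLocalRing_posDegIdeal`). As `σ_F` is primitive, this forces `σ_F(β) = 1`, and
the rest of the condition is `grp(S ∩ F) = grp(S) ∩ H_F` (`facet_conditions_iff`).
-/

/-! ### Localizations with principal maximal ideal -/

/-- The localization of a Noetherian domain at a prime is regular as soon as its maximal ideal is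
principal: it is then a field or a discrete valuation ring. -/
theorem isRegularLocalRing_localization_of_isPrincipal {R : Type*} [CommRing R] [IsDomain R]
    [IsNoetherianRing R] (P : Ideal R) [P.IsPrime]
    (h : (P.map (algebraMap R (Localization.AtPrime P))).IsPrincipal) :
    IsRegularLocalRing (Localization.AtPrime P) := by
  have : IsNoetherianRing (Localization.AtPrime P) :=
    IsLocalization.isNoetherianRing P.primeCompl _ inferInstance
  have : IsDomain (Localization.AtPrime P) :=
    IsLocalization.isDomain_localization P.primeCompl_le_nonZeroDivisors
  rw [IsLocalization.AtPrime.map_eq_maximalIdeal] at h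
  have : IsPrincipalIdealRing (Localization.AtPrime P) :=
    ((tfae_of_isNoetherianRing_of_isLocalRing_of_isDomain _).out 0 4).2 h
  infer_instance

/-- A regular local domain of dimension at most one is a principal ideal ring. -/
theorem IsRegularLocalRing.isPrincipalIdealRing_of_ringKrullDim_le_one {A : Type*} [CommRing A]
    [IsDomain A] [IsRegularLocalRing A] (h : ringKrullDim A ≤ 1) : IsPrincipalIdealRing A := by
  refine ((tfae_of_isNoetherianRing_of_isLocalRing_of_isDomain A).out 0 5).2 ?_
  have := (IsRegularLocalRing.iff_finrank_cotangentSpace A).1 inferInstance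
  rw [← this] at h
  exact_mod_cast h

/-- Unique factorization domains satisfy `R_1`, since their primes of height one are principal. -/
theorem UniqueFactorizationMonoid.satisfiesSerreR_one {R : Type*} [CommRing R] [IsDomain R]
    [IsNoetherianRing R] [UniqueFactorizationMonoid R] : SatisfiesSerreR 1 R := by
  intro P _ hP
  apply isRegularLocalRing_localization_of_isPrincipal
  suffices h : P.IsPrincipal by
    exact Submodule.IsPrincipal.map_ringHom _ h
  rcases eq_or_ne P ⊥ with rfl | h
  · infer_instance
  · refine isPrincipal_of_height_eq_one (le_antisymm hP ?_)
    rw [Order.one_le_iff_ne_zero]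
    exact fun h0 => h ((Ideal.height_eq_zero_iff_eq_bot).1 h0)

theorem SatisfiesSerreR.of_ringEquiv {k : ℕ} {R R' : Type*} [CommRing R] [CommRing R']
    (e : R ≃+* R') (h : SatisfiesSerreR k R) : SatisfiesSerreR k R' := by
  intro P _ hP
  have := h (P.comap e) (by rwa [RingEquiv.height_comap])
  exact IsRegularLocalRing.of_ringEquiv (IsLocalization.ringEquivOfRingEquiv
    (M := (P.comap e).primeCompl) (T := P.primeCompl) (Localization.AtPrime (P.comap e))
    (Localization.AtPrime P) e (by
      ext x
      simp only [Submonoid.mem_map]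
      constructor
      · rintro ⟨y, hy, rfl⟩
        exact hy
      · intro hx
        exact ⟨e.symm x, fun h => hx (by simpa using Ideal.mem_comap.1 h), by simp⟩))

/-- If a localization `R'` of `R` satisfies `R_k`, then `R` is regular at all primes of height at
most `k` that survive in `R'`. -/
theorem SatisfiesSerreR.isRegularLocalRing_of_isLocalization {k : ℕ} {R R' : Type*} [CommRing R]
    [CommRing R'] [Algebra R R'] (M : Submonoid R) [IsLocalization M R']
    (h : SatisfiesSerreR k R') (P : Ideal R) [P.IsPrime] (hP : P.height ≤ (k : ℕ∞))
    (hd : Disjoint (M : Set R) (P : Set R)) : IsRegularLocalRing (Localization.AtPrime P) := by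
  have := IsLocalization.isPrime_of_isPrime_disjoint M R' P ‹_› hd
  have h1 := h (P.map (algebraMap R R')) (by rwa [IsLocalization.height_map_of_disjoint M P hd])
  have h2 := IsLocalization.isLocalization_isLocalization_atPrime_isLocalization (M := M)
    (Localization.AtPrime (P.map (algebraMap R R'))) (P.map (algebraMap R R'))
  have h3 := IsLocalization.under_map_of_isPrime_disjoint M R' ‹P.IsPrime› hd
  rw [Ideal.under_def] at h3
  simp_rw [h3] at h2
  exact IsRegularLocalRing.of_ringEquiv (IsLocalization.algEquiv P.primeCompl
    (Localization.AtPrime (P.map (algebraMap R R'))) (Localization.AtPrime P)).toRingEquiv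

/-! ### The prime ideal of monomials of positive degree -/

namespace AddMonoidAlgebra

variable {K : Type*} [Field K] {M : Type*} [AddCommMonoid M]

open scoped Classical in
/-- The projection of `K[M]` onto its part of degree zero, for the grading given by `d`. It is
multiplicative because degrees are nonnegative. -/
noncomputable def degZeroHom (K : Type*) [Field K] (d : M →+ ℕ) :
    AddMonoidAlgebra K M →ₐ[K] AddMonoidAlgebra K M :=
  lift K (AddMonoidAlgebra K M) M
    { toFun m := if d m.toAdd = 0 then single m.toAdd 1 else 0
      map_one' := by simp [one_def]
      map_mul' a b := by
        by_cases ha : d a.toAdd = 0 <;> by_cases hb : d b.toAdd = 0 <;>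
          simp [ha, hb, single_mul_single] }

/-- The ideal of `K[M]` spanned by the monomials of positive degree, defined as the kernel of the
projection onto degree zero; see `posDegIdeal_eq_span`. -/
noncomputable def posDegIdeal (K : Type*) [Field K] (d : M →+ ℕ) :
    Ideal (AddMonoidAlgebra K M) :=
  RingHom.ker (degZeroHom K d)

open scoped Classical in
theorem degZeroHom_single (d : M →+ ℕ) (m : M) (r : K) :
    degZeroHom K d (single m r) = if d m = 0 then single m r else 0 := by
  rw [degZeroHom, lift_single]
  simp

open scoped Classical in
theorem coeff_degZeroHom (d : M →+ ℕ) (f : AddMonoidAlgebra K M) (m : M) :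
    (degZeroHom K d f).coeff m = if d m = 0 then f.coeff m else 0 := by
  induction f using induction_linear with
  | zero => simp
  | add f g hf hg =>
    rw [map_add, coeff_add, Finsupp.add_apply, hf, hg, coeff_add, Finsupp.add_apply]
    split_ifs <;> simp
  | single a r =>
    rw [degZeroHom_single]
    by_cases h : a = m
    · subst h; split_ifs <;> simp
    · split_ifs <;> simp [h]

theorem mem_posDegIdeal {d : M →+ ℕ} {f : AddMonoidAlgebra K M} :
    f ∈ posDegIdeal K d ↔ ∀ m, d m = 0 → f.coeff m = 0 := by
  classical
  rw [posDegIdeal, RingHom.mem_ker]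
  change degZeroHom K d f = 0 ↔ _
  rw [← coeff_inj, Finsupp.ext_iff]
  simp [coeff_degZeroHom]

theorem single_mem_posDegIdeal {d : M →+ ℕ} {m : M} :
    single m (1 : K) ∈ posDegIdeal K d ↔ d m ≠ 0 := by
  rw [mem_posDegIdeal]
  constructor
  · intro h h0
    simpa using h m h0
  · intro h a ha
    rw [coeff_single, Finsupp.single_eq_of_ne]
    rintro rfl
    exact h ha

theorem posDegIdeal_eq_span (d : M →+ ℕ) :
    posDegIdeal K d = Ideal.span ((fun m => single m (1 : K)) '' {m | d m ≠ 0}) := by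
  apply le_antisymm
  · intro f hf
    rw [← sum_coeff_single f]
    refine Ideal.sum_mem _ fun m hm => ?_
    have hs : single m (f.coeff m) = single 0 (f.coeff m) * single m (1 : K) := by
      simp [single_mul_single]
    rw [hs]
    refine Ideal.mul_mem_left _ _ (Ideal.subset_span ⟨m, fun h0 => ?_, rfl⟩)
    exact Finsupp.mem_support_iff.1 hm (mem_posDegIdeal.1 hf m h0)
  · rw [Ideal.span_le]
    rintro _ ⟨m, hm, rfl⟩
    exact single_mem_posDegIdeal.2 hm

theorem posDegIdeal_le {d : M →+ ℕ} {P : Ideal (AddMonoidAlgebra K M)}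
    (h : ∀ m, d m ≠ 0 → single m (1 : K) ∈ P) : posDegIdeal K d ≤ P := by
  rw [posDegIdeal_eq_span, Ideal.span_le]
  rintro _ ⟨m, hm, rfl⟩
  exact h m hm

/-- The ideal is prime because it is the kernel of a homomorphism into a domain. -/
instance [IsDomain (AddMonoidAlgebra K M)] (d : M →+ ℕ) : (posDegIdeal K d).IsPrime :=
  RingHom.ker_isPrime (degZeroHom K d : AddMonoidAlgebra K M →+* AddMonoidAlgebra K M)

/-- Comparing the parts of lowest degree on both sides of `χ^p f = χ^q g`, where `f` and `g` have
nonzero part of degree zero, shows that `p` and `q` agree up to elements of degree zero. -/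
theorem exists_add_eq_add_of_single_mul_eq [IsCancelAdd M] {d : M →+ ℕ} {p q : M}
    {f g : AddMonoidAlgebra K M}
    (hf : f ∉ posDegIdeal K d) (hg : g ∉ posDegIdeal K d)
    (h : single p (1 : K) * f = single q (1 : K) * g) :
    ∃ a b, d a = 0 ∧ d b = 0 ∧ p + a = q + b := by
  -- every monomial of the left side is divisible by `χ^q`
  have key : ∀ {p q : M} {f g : AddMonoidAlgebra K M}, single p (1 : K) * f = single q (1 : K) * g →
      ∀ a, f.coeff a ≠ 0 → ∃ b, p + a = q + b := by
    intro p q f g h a ha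
    by_contra! hb
    have h1 := congrArg (fun x => x.coeff (p + a)) h
    simp only [coeff_single_mul_add, one_mul] at h1
    rw [coeff_single_mul_of_forall_add_ne _ _ fun b => (hb b).symm] at h1
    exact ha h1
  rw [mem_posDegIdeal] at hf hg
  push Not at hf hg
  obtain ⟨a, ha, hfa⟩ := hf
  obtain ⟨a', ha', hga'⟩ := hg
  obtain ⟨b, hb⟩ := key h a hfa
  obtain ⟨b', hb'⟩ := key h.symm a' hga'
  refine ⟨a, b, ha, ?_, hb⟩
  have h1 := congrArg d hb
  have h2 := congrArg d hb'
  simp only [map_add] at h1 h2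
  omega

variable [IsDomain (AddMonoidAlgebra K M)]

/-- If all monomials of positive degree are, up to monomials of degree zero, powers of one of
them, then this monomial generates the maximal ideal of the localization at the ideal of positive
degree elements, which is therefore regular. -/
theorem isRegularLocalRing_posDegIdeal [IsNoetherianRing (AddMonoidAlgebra K M)] {d : M →+ ℕ}
    {β : M} (hβ : d β ≠ 0)
    (h : ∀ γ, ∃ (k : ℕ) (a b : M), d a = 0 ∧ d b = 0 ∧ γ + a = k • β + b) :
    IsRegularLocalRing (Localization.AtPrime (posDegIdeal K d)) := by
  apply isRegularLocalRing_localization_of_isPrincipal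
  set A := Localization.AtPrime (posDegIdeal K d)
  refine ⟨algebraMap _ A (single β (1 : K)), le_antisymm ?_ ?_⟩
  · rw [Ideal.map_le_iff_le_comap]
    refine posDegIdeal_le fun γ hγ => ?_
    obtain ⟨k, a, b, ha, hb, hab⟩ := h γ
    have hk : k ≠ 0 := by
      rintro rfl
      have := congrArg d hab
      simp [ha, hb] at this
      exact hγ this
    have hu : IsUnit (algebraMap _ A (single a (1 : K))) :=
      IsLocalization.map_units A (⟨single a 1, fun h => single_mem_posDegIdeal.1 h ha⟩ :
        (posDegIdeal K d).primeCompl)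
    have he : single γ (1 : K) * single a 1 = single β 1 ^ k * single b 1 := by
      rw [single_mul_single, hab, single_pow, single_mul_single]
      simp
    change algebraMap _ A (single γ (1 : K)) ∈ Ideal.span {algebraMap _ A (single β (1 : K))}
    rw [Ideal.mem_span_singleton, ← hu.dvd_mul_right, ← map_mul, he, map_mul, map_pow]
    exact (dvd_pow_self _ hk).mul_right _
  · rw [Submodule.span_singleton_le_iff_mem]
    exact Ideal.mem_map_of_mem _ (single_mem_posDegIdeal.2 hβ)

/-- Conversely, if the localization at the ideal of positive degree elements is a discrete
valuation ring, then some monomial is a uniformizer, and every monomial is a unit times a power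
of it. -/
theorem exists_of_isRegularLocalRing_posDegIdeal [IsCancelAdd M] {d : M →+ ℕ} (hd : d ≠ 0)
    (hP : (posDegIdeal K d).height ≤ 1)
    (hreg : IsRegularLocalRing (Localization.AtPrime (posDegIdeal K d))) :
    ∃ β, d β ≠ 0 ∧ ∀ γ, ∃ (k : ℕ) (a b : M), d a = 0 ∧ d b = 0 ∧ γ + a = k • β + b := by
  set P := posDegIdeal K d with hPdef
  set A := Localization.AtPrime P with hA
  have hdom : IsDomain A := IsLocalization.isDomain_localization P.primeCompl_le_nonZeroDivisors
  have hinj : Function.Injective (algebraMap (AddMonoidAlgebra K M) A) :=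
    IsLocalization.injective A P.primeCompl_le_nonZeroDivisors
  have hpid : IsPrincipalIdealRing A := by
    apply IsRegularLocalRing.isPrincipalIdealRing_of_ringKrullDim_le_one
    rw [IsLocalization.AtPrime.ringKrullDim_eq_height P]
    exact_mod_cast hP
  have hmax := IsLocalization.AtPrime.map_eq_maximalIdeal P A
  obtain ⟨γ₀, hγ₀⟩ : ∃ γ, d γ ≠ 0 := by
    by_contra! h
    exact hd (AddMonoidHom.ext h)
  have hne : IsLocalRing.maximalIdeal A ≠ ⊥ := by
    intro h
    rw [← hmax, Ideal.map_eq_bot_iff_of_injective hinj] at h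
    have := single_mem_posDegIdeal (K := K).2 hγ₀
    rw [← hPdef, h] at this
    simp at this
  have hdvr : IsDiscreteValuationRing A := { not_a_field' := hne }
  obtain ⟨ϖ, hϖ⟩ := IsDiscreteValuationRing.exists_irreducible A
  have hϖm := (IsDiscreteValuationRing.irreducible_iff_uniformizer ϖ).1 hϖ
  have hpow : ∀ γ : M, ∃ k, Associated (algebraMap _ A (single γ (1 : K))) (ϖ ^ k) := fun γ =>
    IsDiscreteValuationRing.associated_pow_irreducible
      (by rw [Ne, map_eq_zero_iff _ hinj]; simp) hϖ
  -- the monomials of positive degree generate the maximal ideal, so not all lie in its square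
  obtain ⟨β, hβ, hβϖ⟩ : ∃ β, d β ≠ 0 ∧ Associated (algebraMap _ A (single β (1 : K))) ϖ := by
    by_contra! hcon
    have hle : IsLocalRing.maximalIdeal A ≤ Ideal.span {ϖ ^ 2} := by
      rw [← hmax, Ideal.map_le_iff_le_comap]
      refine posDegIdeal_le fun γ hγ => ?_
      rw [Ideal.mem_comap]
      obtain ⟨k, hk⟩ := hpow γ
      have hmem : algebraMap _ A (single γ (1 : K)) ∈ IsLocalRing.maximalIdeal A := by
        rw [← hmax]
        exact Ideal.mem_map_of_mem _ (single_mem_posDegIdeal.2 hγ)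
      refine Ideal.mem_span_singleton.2 ((pow_dvd_pow ϖ ?_).trans hk.symm.dvd)
      by_contra! hk2
      interval_cases k
      · rw [pow_zero, associated_one_iff_isUnit] at hk
        exact (IsLocalRing.mem_maximalIdeal _).1 hmem hk
      · exact hcon γ hγ (by simpa using hk)
    rw [hϖm, Ideal.span_singleton_le_span_singleton] at hle
    have h12 := (pow_dvd_pow_iff hϖ.ne_zero hϖ.not_isUnit (n := 2) (m := 1)).1 (by simpa using hle)
    omega
  refine ⟨β, hβ, fun γ => ?_⟩
  obtain ⟨k, hk⟩ := hpow γ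
  -- write the unit `u` with `χ^γ u = χ^{kβ}` as a fraction `g / f`
  obtain ⟨u, hu⟩ := hk.trans (hβϖ.pow_pow (n := k)).symm
  obtain ⟨g, f, hgf⟩ := IsLocalization.exists_mk'_eq P.primeCompl (u : A)
  have hg : g ∈ P.primeCompl :=
    (IsLocalization.AtPrime.isUnit_mk'_iff A P g f).1 (hgf ▸ u.isUnit)
  have heq : single γ (1 : K) * g =
      single (k • β) (1 : K) * (f : AddMonoidAlgebra K M) := by
    apply hinj
    have h1 : (single β (1 : K)) ^ k = single (k • β) 1 := by rw [single_pow]; simp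
    rw [map_mul, map_mul, ← h1, map_pow, ← hu, ← IsLocalization.mk'_spec A g f, hgf]
    ring
  obtain ⟨a, b, ha, hb, hab⟩ := exists_add_eq_add_of_single_mul_eq hg f.2 heq
  exact ⟨k, a, b, ha, hb, hab⟩

end AddMonoidAlgebra

/-! ### Primes without monomials -/

namespace AddMonoidAlgebra

variable {K : Type*} [Field K] {M G : Type*} [AddCommMonoid M] [AddCommGroup G]

/-- If `G` is the group of differences of its submonoid `M`, then `K[G]` is the localization of
`K[M]` at the monomials. -/
theorem isLocalization_mapDomainRingHom (f : M →+ G) (hf : Function.Injective f)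
    (hG : ∀ g, ∃ a b, g = f a - f b) :
    letI := (mapDomainRingHom K f).toAlgebra
    IsLocalization (MonoidHom.mrange (of K M)) (AddMonoidAlgebra K G) := by
  let := (mapDomainRingHom K f).toAlgebra
  have halg : ∀ x, algebraMap (AddMonoidAlgebra K M) (AddMonoidAlgebra K G) x =
    mapDomainRingHom K f x := fun _ => rfl
  refine ⟨?_, ?_, ?_⟩
  · rintro ⟨_, m, rfl⟩
    refine IsUnit.of_mul_eq_one (single (-f m.toAdd) 1) ?_
    rw [halg]
    simp [single_mul_single, one_def]
  · intro z
    induction z using induction_linear with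
    | zero => exact ⟨(0, 1), by simp⟩
    | add z w hz hw =>
      obtain ⟨⟨x, s⟩, hx⟩ := hz
      obtain ⟨⟨y, t⟩, hy⟩ := hw
      refine ⟨(x * t + y * s, s * t), ?_⟩
      simp only [Submonoid.coe_mul, map_mul, map_add] at hx hy ⊢
      rw [← hx, ← hy]
      ring
    | single g r =>
      obtain ⟨a, b, rfl⟩ := hG g
      refine ⟨(single a r, ⟨_, Multiplicative.ofAdd b, rfl⟩), ?_⟩
      rw [halg, halg]
      simp [single_mul_single]
  · intro x y hxy
    exact ⟨1, by rw [mapDomain_injective hf hxy]⟩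

/-- A localization of a polynomial ring at its monomials satisfies `R_1`, since it is a Noetherian
unique factorization domain. -/
theorem satisfiesSerreR_one_of_finsupp {σ : Type*} [Finite σ] (f : (σ →₀ ℕ) →+ G)
    (hf : Function.Injective f) (hG : ∀ g, ∃ a b, g = f a - f b) :
    SatisfiesSerreR 1 (AddMonoidAlgebra K G) := by
  let : Algebra (AddMonoidAlgebra K (σ →₀ ℕ)) (AddMonoidAlgebra K G) :=
    (mapDomainRingHom K f).toAlgebra
  let N : Submonoid (AddMonoidAlgebra K (σ →₀ ℕ)) := MonoidHom.mrange (of K (σ →₀ ℕ))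
  have hloc : IsLocalization N (AddMonoidAlgebra K G) := isLocalization_mapDomainRingHom f hf hG
  have hN : N ≤ nonZeroDivisors (AddMonoidAlgebra K (σ →₀ ℕ)) := by
    rintro _ ⟨m, rfl⟩
    rw [mem_nonZeroDivisors_iff_ne_zero]
    exact fun h => one_ne_zero (single_eq_zero.1 h)
  have hUFD : UniqueFactorizationMonoid (MvPolynomial σ K) := inferInstance
  have : IsDomain (AddMonoidAlgebra K G) := IsLocalization.isDomain_of_le_nonZeroDivisors _ hN
  have hNoeth : IsNoetherianRing (MvPolynomial σ K) := inferInstance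
  have : IsNoetherianRing (AddMonoidAlgebra K G) :=
    IsLocalization.isNoetherianRing N _ hNoeth
  have : UniqueFactorizationMonoid (AddMonoidAlgebra K G) :=
    have : UniqueFactorizationMonoid (AddMonoidAlgebra K (σ →₀ ℕ)) := hUFD
    UniqueFactorizationMonoid.of_isLocalization N _
  exact UniqueFactorizationMonoid.satisfiesSerreR_one

/-- Laurent polynomial rings satisfy `R_1`. -/
theorem satisfiesSerreR_one_of_free [Module.Free ℤ G] [Module.Finite ℤ G] :
    SatisfiesSerreR 1 (AddMonoidAlgebra K G) := by
  let b := Module.finBasis ℤ G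
  refine satisfiesSerreR_one_of_finsupp (b.repr.symm.toAddEquiv.toAddMonoidHom.comp
    (Finsupp.mapRange.addMonoidHom (Nat.castAddMonoidHom ℤ))) ?_ fun g => ?_
  · exact b.repr.symm.injective.comp
      (Finsupp.mapRange_injective _ (by simp) Nat.cast_injective)
  · refine ⟨(b.repr g).mapRange Int.toNat rfl, (-b.repr g).mapRange Int.toNat rfl, ?_⟩
    apply b.repr.injective
    ext i
    simp

/-- `K[M]` is regular at the primes of height at most one that contain no monomial. -/
theorem isRegularLocalRing_of_forall_single_notMem [Module.Free ℤ G] [Module.Finite ℤ G]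
    (f : M →+ G) (hf : Function.Injective f) (hG : ∀ g, ∃ a b, g = f a - f b)
    (P : Ideal (AddMonoidAlgebra K M)) [P.IsPrime] (hP : P.height ≤ 1)
    (h : ∀ m, single m (1 : K) ∉ P) : IsRegularLocalRing (Localization.AtPrime P) := by
  let := (mapDomainRingHom K f).toAlgebra
  have := isLocalization_mapDomainRingHom (K := K) f hf hG
  refine (satisfiesSerreR_one_of_free (K := K) (G := G)).isRegularLocalRing_of_isLocalization
    (MonoidHom.mrange (of K M)) P hP ?_
  rw [Set.disjoint_left]
  rintro _ ⟨m, rfl⟩ hm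
  exact h _ hm

end AddMonoidAlgebra

/-! ### Farkas' lemma and faces of affine semigroups -/

/-- **Farkas' lemma** for finitely many vectors over an ordered field. For the induction step, let
`φ` separate `b` from all vectors but `a 0`. If `φ (a 0) < 0`, then project along `a 0` onto the
kernel of `φ`. -/
theorem exists_nonneg_sum_smul_eq_or_exists_dual {𝕜 V : Type*} [Field 𝕜] [LinearOrder 𝕜]
    [IsStrictOrderedRing 𝕜] [AddCommGroup V] [Module 𝕜 V] (m : ℕ) (a : Fin m → V) (b : V) :
    (∃ c : Fin m → 𝕜, (∀ i, 0 ≤ c i) ∧ ∑ i, c i • a i = b) ∨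
      ∃ φ : V →ₗ[𝕜] 𝕜, (∀ i, 0 ≤ φ (a i)) ∧ φ b < 0 := by
  induction m generalizing b with
  | zero =>
    rcases eq_or_ne b 0 with rfl | hb
    · exact .inl ⟨0, by simp, by simp⟩
    · obtain ⟨φ, hφ, -⟩ := Submodule.exists_le_ker_of_notMem (K := 𝕜) (p := (⊥ : Submodule 𝕜 V))
        (v := b) (by simpa using hb)
      refine .inr ?_
      rcases hφ.lt_or_gt with h | h
      · exact ⟨φ, fun i => i.elim0, h⟩
      · exact ⟨-φ, fun i => i.elim0, by simpa using h⟩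
  | succ m ih =>
    rcases ih (fun i => a i.succ) b with ⟨c, hc, hb⟩ | ⟨φ, hφ, hb⟩
    · refine .inl ⟨Fin.cons 0 c, fun i => ?_, by simp [Fin.sum_univ_succ, hb]⟩
      cases i using Fin.cases <;> simp [hc]
    rcases le_or_gt 0 (φ (a 0)) with h0 | h0
    · refine .inr ⟨φ, fun i => ?_, hb⟩
      cases i using Fin.cases <;> simp [h0, hφ]
    let π : V →ₗ[𝕜] V := LinearMap.id - ((φ (a 0))⁻¹ • φ).smulRight (a 0)
    have hπ : ∀ v, π v = v - ((φ (a 0))⁻¹ * φ v) • a 0 := fun v => by simp [π]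
    rcases ih (fun i => π (a i.succ)) (π b) with ⟨c, hc, hcb⟩ | ⟨ψ, hψ, hψb⟩
    · refine .inl ⟨Fin.cons ((φ (a 0))⁻¹ * φ b + ∑ i, c i * (-(φ (a 0))⁻¹ * φ (a i.succ))) c,
        fun i => ?_, ?_⟩
      · have h1 : (φ (a 0))⁻¹ < 0 := inv_lt_zero.2 h0
        cases i using Fin.cases with
        | zero =>
          refine add_nonneg (mul_pos_of_neg_of_neg h1 hb).le (Finset.sum_nonneg fun i _ => ?_)
          exact mul_nonneg (hc i) (mul_nonneg (neg_pos.2 h1).le (hφ i))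
        | succ i => exact hc i
      · simp only [hπ, smul_sub, Finset.sum_sub_distrib] at hcb
        rw [sub_eq_iff_eq_add] at hcb
        simp only [Fin.sum_univ_succ, Fin.cons_zero, Fin.cons_succ, hcb, add_smul, Finset.sum_smul,
          smul_smul, neg_mul, mul_neg, neg_smul, Finset.sum_neg_distrib]
        abel
    · refine .inr ⟨ψ.comp π, fun i => ?_, hψb⟩
      cases i using Fin.cases with
      | zero => simp [hπ, h0.ne]
      | succ i => exact hψ i

namespace AffineSemigroup

variable {n : ℕ} {S : AddSubmonoid (Fin n → ℤ)}

theorem toReal_mem_pos {α : Fin n → ℤ} (hα : α ∈ S) : toReal n α ∈ pos S :=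
  PointedCone.subset_hull ⟨α, hα, rfl⟩

theorem nonneg_on_pos {φ : (Fin n → ℝ) →ₗ[ℝ] ℝ} (h : ∀ α ∈ S, 0 ≤ φ (toReal n α)) :
    ∀ x ∈ pos S, 0 ≤ φ x := by
  intro x hx
  obtain ⟨c, hc, hc0, rfl⟩ := PointedCone.mem_hull_set.1 hx
  rw [Finsupp.sum, map_sum]
  refine Finset.sum_nonneg fun y hy => ?_
  obtain ⟨α, hα, rfl⟩ := hc hy
  rw [map_smul]
  exact mul_nonneg (hc0 _) (h α hα)

/-- A common denominator for finitely many nonnegative rationals. -/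
theorem exists_nat_mul_eq {m : ℕ} (c : Fin m → ℚ) (hc : ∀ i, 0 ≤ c i) :
    ∃ N : ℕ, 0 < N ∧ ∃ k : Fin m → ℕ, ∀ i, (N : ℚ) * c i = k i := by
  refine ⟨∏ i, (c i).den, Finset.prod_pos fun i _ => (c i).den_pos,
    fun i => (c i).num.toNat * ∏ j ∈ Finset.univ.erase i, (c j).den, fun i => ?_⟩
  rw [← Finset.mul_prod_erase _ _ (Finset.mem_univ i)]
  have h1 : (((c i).num.toNat : ℤ) : ℚ) = (c i).num := by
    rw [Int.toNat_of_nonneg (Rat.num_nonneg.2 (hc i))]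
  push_cast at h1 ⊢
  rw [h1, mul_right_comm, mul_comm ((c i).den : ℚ), Rat.mul_den_eq_num]

/-- A proper face `T` of a finitely generated `S` lies on a supporting hyperplane of `S`. If there
were none, then Farkas' lemma would present the negative of the sum of the generators of `S` as a
combination of generators of `S` and of negatives of elements of `T`; clearing denominators, some
positive multiple of this sum would be a summand of an element of `T`. -/
theorem exists_supporting_form (hS : S.FG) (T : AddSubmonoid (Fin n → ℤ))
    (hface : ∀ a ∈ S, ∀ b ∈ S, a + b ∈ T → a ∈ T) (hne : ∃ a ∈ S, a ∉ T) :
    ∃ φ : (Fin n → ℝ) →ₗ[ℝ] ℝ, (∀ α ∈ S, 0 ≤ φ (toReal n α)) ∧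
      (∀ α ∈ S, α ∈ T → φ (toReal n α) = 0) ∧ ∃ α ∈ S, φ (toReal n α) ≠ 0 := by
  classical
  obtain ⟨s, hs⟩ := hS
  have hsS : ∀ g ∈ s, g ∈ S := fun g hg => hs ▸ AddSubmonoid.subset_closure hg
  let ι : (Fin n → ℤ) →+ (Fin n → ℚ) := (Int.castAddHom ℚ).compLeft (Fin n)
  have hι : Function.Injective ι := fun x y hxy => by
    ext i
    have := congrFun hxy i
    simpa [ι] using this
  let g : Fin s.card → (Fin n → ℤ) := fun i => s.equivFin.symm i
  have hg : ∀ i, g i ∈ S := fun i => hsS _ (s.equivFin.symm i).2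
  have hgs : ∀ x ∈ s, ∃ i, g i = x := fun x hx => ⟨s.equivFin ⟨x, hx⟩, by simp [g]⟩
  let h : Fin n → ℤ := ∑ x ∈ s with x ∈ T, x
  have hhT : h ∈ T := AddSubmonoid.sum_mem _ fun x hx => (Finset.mem_filter.1 hx).2
  have hsum : ∑ x ∈ s, x ∈ S := AddSubmonoid.sum_mem _ hsS
  rcases exists_nonneg_sum_smul_eq_or_exists_dual (𝕜 := ℚ) (s.card + 1)
    (Fin.cons (-ι h) (fun i => ι (g i))) (-ι (∑ x ∈ s, x)) with ⟨c, hc, hcb⟩ | ⟨φ, hφ, hφb⟩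
  · exfalso
    obtain ⟨N, hN, k, hk⟩ := exists_nat_mul_eq c hc
    have heq : N • (∑ x ∈ s, x) + ∑ i, k (Fin.succ i) • g i = k 0 • h := by
      apply hι
      have h1 := congrArg (fun v => (N : ℚ) • v) hcb
      simp only [Fin.sum_univ_succ, Fin.cons_zero, Fin.cons_succ, smul_add, Finset.smul_sum,
        smul_smul, hk, smul_neg] at h1
      simp only [map_add, map_nsmul, map_sum] at h1 ⊢
      simp only [← Nat.cast_smul_eq_nsmul ℚ, Finset.smul_sum] at h1 ⊢
      rw [← sub_eq_zero]
      rw [← sub_eq_zero] at h1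
      rw [← h1]
      abel
    have h2 : N • (∑ x ∈ s, x) + ∑ i, k (Fin.succ i) • g i ∈ T :=
      heq ▸ AddSubmonoid.nsmul_mem _ hhT _
    have h3 : N • (∑ x ∈ s, x) ∈ T := hface _ (S.nsmul_mem hsum _) _
      (AddSubmonoid.sum_mem _ fun i _ => S.nsmul_mem (hg i) _) h2
    obtain ⟨N, rfl⟩ := Nat.exists_eq_succ_of_ne_zero hN.ne'
    have h4 : ∑ x ∈ s, x ∈ T := hface _ hsum _ (S.nsmul_mem hsum N) (by rwa [← succ_nsmul'])
    obtain ⟨a, haS, haT⟩ := hne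
    refine haT ?_
    rw [← hs] at haS
    refine (AddSubmonoid.closure_le (S := T)).2 (fun x hx => ?_) haS
    rw [← Finset.add_sum_erase _ _ hx] at h4
    exact hface _ (hsS x hx) _
      (AddSubmonoid.sum_mem _ fun y hy => hsS y (Finset.mem_of_mem_erase hy)) h4
  · let Φ : (Fin n → ℝ) →ₗ[ℝ] ℝ :=
      ∑ i, ((φ (Pi.single i 1) : ℚ) : ℝ) • LinearMap.proj i
    have hΦ : ∀ α, Φ (toReal n α) = (φ (ι α) : ℚ) := by
      intro α
      have h1 : ι α = ∑ i, (α i : ℚ) • Pi.single i (1 : ℚ) := by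
        ext j
        simp [ι, Finset.sum_apply, Pi.single_apply]
      rw [h1, map_sum]
      simp [Φ, toReal, mul_comm]
    have hgen : ∀ x ∈ s, 0 ≤ φ (ι x) := by
      intro x hx
      obtain ⟨i, rfl⟩ := hgs x hx
      simpa using hφ i.succ
    have hnn : ∀ α ∈ S, 0 ≤ φ (ι α) := by
      intro α hα
      rw [← hs] at hα
      induction hα using AddSubmonoid.closure_induction with
      | mem x hx => exact hgen x hx
      | zero => simp
      | add x y _ _ hx hy => rw [map_add, map_add]; exact add_nonneg hx hy
    have hh0 : φ (ι h) ≤ 0 := by simpa using hφ 0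
    have hgT : ∀ x ∈ s, x ∈ T → φ (ι x) = 0 := by
      intro x hx hxT
      refine le_antisymm (le_trans ?_ hh0) (hgen x hx)
      rw [map_sum, map_sum]
      exact Finset.single_le_sum (f := fun y => φ (ι y))
        (fun y hy => hgen y (Finset.mem_filter.1 hy).1) (Finset.mem_filter.2 ⟨hx, hxT⟩)
    refine ⟨Φ, fun α hα => ?_, fun α hα hαT => ?_, ∑ x ∈ s, x, hsum, ?_⟩
    · rw [hΦ]
      exact_mod_cast hnn α hα
    · rw [hΦ, Rat.cast_eq_zero]
      rw [← hs] at hα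
      induction hα using AddSubmonoid.closure_induction with
      | mem x hx => exact hgT x hx hαT
      | zero => simp
      | add x y hx hy ihx ihy =>
        rw [hs] at hx hy
        rw [map_add, map_add, ihx (hface _ hx _ hy hαT),
          ihy (hface _ hy _ hx (by rwa [add_comm])), add_zero]
    · rw [hΦ, Rat.cast_ne_zero]
      rw [map_neg, neg_neg_iff_pos] at hφb
      exact hφb.ne'

end AffineSemigroup

/-! ### Facets -/

namespace AffineSemigroup

variable {n : ℕ} {S : AddSubmonoid (Fin n → ℤ)}

/-- Tilting a supporting form `φ` whose zero set on the cone has codimension at least two: there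
is a supporting form which vanishes on a face of strictly larger dimension. -/
theorem exists_supporting_form_of_finrank_lt (hS : S.FG) {φ : (Fin n → ℝ) →ₗ[ℝ] ℝ}
    (hφ : ∀ α ∈ S, 0 ≤ φ (toReal n α))
    (hlt : Module.finrank ℝ (Submodule.span ℝ {x | x ∈ pos S ∧ φ x = 0}) + 1 <
      Module.finrank ℝ (realSpan S)) :
    ∃ φ' : (Fin n → ℝ) →ₗ[ℝ] ℝ, (∀ α ∈ S, 0 ≤ φ' (toReal n α)) ∧
      (∃ α ∈ S, φ' (toReal n α) ≠ 0) ∧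
      (∀ x ∈ pos S, φ x = 0 → φ' x = 0) ∧
      Module.finrank ℝ (Submodule.span ℝ {x | x ∈ pos S ∧ φ x = 0}) <
        Module.finrank ℝ (Submodule.span ℝ {x | x ∈ pos S ∧ φ' x = 0}) := by
  classical
  set W := Submodule.span ℝ {x | x ∈ pos S ∧ φ x = 0} with hW
  -- a vector `u` in the span of `S` and the kernel of `φ`, but outside of `W`
  obtain ⟨u, huS, hu0, huW⟩ : ∃ u ∈ realSpan S, φ u = 0 ∧ u ∉ W := by
    by_contra! hcon
    let ψ := φ.domRestrict (realSpan S)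
    have h1 : (LinearMap.ker ψ).map (realSpan S).subtype ≤ W := by
      rintro _ ⟨x, hx, rfl⟩
      exact hcon x x.2 hx
    have h2 := Submodule.finrank_mono h1
    rw [(Submodule.equivMapOfInjective _ (realSpan S).subtype_injective _).symm.finrank_eq] at h2
    have h3 := LinearMap.finrank_range_add_finrank_ker ψ
    have h4 := Submodule.finrank_le (LinearMap.range ψ)
    rw [Module.finrank_self] at h4
    omega
  obtain ⟨ψ₀, hψ₀u, hψ₀W⟩ := Submodule.exists_le_ker_of_notMem huW
  obtain ⟨s, hs⟩ := hS
  have hsS : ∀ g ∈ s, g ∈ S := fun g hg => hs ▸ AddSubmonoid.subset_closure hg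
  have hgen : ∀ {χ : (Fin n → ℝ) →ₗ[ℝ] ℝ}, (∀ g ∈ s, χ (toReal n g) = 0) →
      ∀ x ∈ realSpan S, χ x = 0 := by
    intro χ hχ
    suffices h : realSpan S ≤ LinearMap.ker χ from fun x hx => h hx
    rw [realSpan, Submodule.span_le]
    rintro _ ⟨α, hα, rfl⟩
    change χ (toReal n α) = 0
    rw [SetLike.mem_coe, ← hs] at hα
    induction hα using AddSubmonoid.closure_induction with
    | mem x hx => exact hχ x hx
    | zero => simp
    | add x y _ _ hx hy => rw [map_add, map_add, hx, hy, add_zero]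
  obtain ⟨ψ, hψu, hψW, g₀, hg₀, hψg₀⟩ : ∃ ψ : (Fin n → ℝ) →ₗ[ℝ] ℝ, ψ u ≠ 0 ∧
      W ≤ LinearMap.ker ψ ∧ ∃ g ∈ s, ψ (toReal n g) < 0 := by
    by_contra! hcon
    refine hψ₀u (hgen (fun g hg => le_antisymm ?_ (hcon ψ₀ hψ₀u hψ₀W g hg)) u huS)
    have := hcon (-ψ₀) (by simpa using hψ₀u) (fun x hx => by simpa using hψ₀W hx) g hg
    simpa using this
  have hker : ∀ x ∈ pos S, φ x = 0 → ψ x = 0 := fun x hx h0 =>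
    hψW (Submodule.subset_span ⟨hx, h0⟩)
  -- the largest `t` for which `φ + t ψ` is nonnegative on the generators of `S`
  obtain ⟨g, hg, hmin⟩ := Finset.exists_min_image {g ∈ s | ψ (toReal n g) < 0}
    (fun g => φ (toReal n g) / (-ψ (toReal n g))) ⟨g₀, Finset.mem_filter.2 ⟨hg₀, hψg₀⟩⟩
  obtain ⟨hgs, hψg⟩ := Finset.mem_filter.1 hg
  set t := φ (toReal n g) / (-ψ (toReal n g)) with ht
  have hφg : 0 < φ (toReal n g) := lt_of_le_of_ne (hφ g (hsS g hgs)) fun h =>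
    hψg.ne (hker _ (toReal_mem_pos (hsS g hgs)) h.symm)
  have ht0 : 0 < t := div_pos hφg (neg_pos.2 hψg)
  have hker' : ∀ x ∈ pos S, φ x = 0 → (φ + t • ψ) x = 0 := fun x hx h0 => by
    simp [h0, hker x hx h0]
  have hg0 : (φ + t • ψ) (toReal n g) = 0 := by
    simp only [LinearMap.add_apply, LinearMap.smul_apply, smul_eq_mul, ht]
    field_simp [hψg.ne]
    ring
  have hnn : ∀ x ∈ s, 0 ≤ (φ + t • ψ) (toReal n x) := by
    intro x hx
    simp only [LinearMap.add_apply, LinearMap.smul_apply, smul_eq_mul]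
    rcases lt_or_ge (ψ (toReal n x)) 0 with h | h
    · have := hmin x (Finset.mem_filter.2 ⟨hx, h⟩)
      rw [le_div_iff₀ (neg_pos.2 h)] at this
      linarith
    · exact add_nonneg (hφ x (hsS x hx)) (mul_nonneg ht0.le h)
  refine ⟨φ + t • ψ, ?_, ?_, hker', ?_⟩
  · intro α hα
    rw [← hs] at hα
    induction hα using AddSubmonoid.closure_induction with
    | mem x hx => exact hnn x hx
    | zero => simp
    | add x y _ _ hx hy => rw [map_add, map_add]; exact add_nonneg hx hy
  · by_contra! hcon
    have := hgen (fun g hg => hcon g (hsS g hg)) u huS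
    simp [hu0, ht0.ne', hψu] at this
  · apply Submodule.finrank_lt_finrank_of_lt
    refine lt_of_le_of_ne (Submodule.span_mono fun x hx => ⟨hx.1, hker' x hx.1 hx.2⟩) fun h => ?_
    have : toReal n g ∈ W := by
      rw [h]
      exact Submodule.subset_span ⟨toReal_mem_pos (hsS g hgs), hg0⟩
    exact hψg.ne (hψW this)

/-- Every proper face of a finitely generated `S` is contained in a facet of `pos(S)`. -/
theorem exists_isFacet_of_face (hS : S.FG) (T : AddSubmonoid (Fin n → ℤ))
    (hface : ∀ a ∈ S, ∀ b ∈ S, a + b ∈ T → a ∈ T) (hne : ∃ a ∈ S, a ∉ T) :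
    ∃ F, IsFacet (pos S) F ∧ ∀ α ∈ S, α ∈ T → toReal n α ∈ F := by
  classical
  let p : ℕ → Prop := fun r => ∃ φ : (Fin n → ℝ) →ₗ[ℝ] ℝ, (∀ α ∈ S, 0 ≤ φ (toReal n α)) ∧
    (∀ α ∈ S, α ∈ T → φ (toReal n α) = 0) ∧ (∃ α ∈ S, φ (toReal n α) ≠ 0) ∧
    Module.finrank ℝ (Submodule.span ℝ {x | x ∈ pos S ∧ φ x = 0}) = r
  have hbound : ∀ r, p r → r < Module.finrank ℝ (realSpan S) := by
    rintro _ ⟨φ, -, -, ⟨α, hα, hφα⟩, rfl⟩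
    apply Submodule.finrank_lt_finrank_of_lt
    rw [← span_pos]
    refine lt_of_le_of_ne (Submodule.span_mono fun x hx => hx.1) fun h => hφα ?_
    have h1 : toReal n α ∈ Submodule.span ℝ {x | x ∈ pos S ∧ φ x = 0} := by
      rw [h]
      exact Submodule.subset_span (toReal_mem_pos hα)
    have h2 : Submodule.span ℝ {x | x ∈ pos S ∧ φ x = 0} ≤ LinearMap.ker φ :=
      Submodule.span_le.2 fun x hx => hx.2
    exact h2 h1
  obtain ⟨φ₀, h1, h2, h3⟩ := exists_supporting_form hS T hface hne
  have hp : ∃ r, p r := ⟨_, φ₀, h1, h2, h3, rfl⟩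
  obtain ⟨r, hr⟩ := hp
  -- choose `φ` such that the dimension of its zero set is as large as possible
  obtain ⟨φ, hφ, hφT, hφ0, hφr⟩ :=
    Nat.findGreatest_spec (P := p) (hbound r hr).le hr
  refine ⟨{x | x ∈ pos S ∧ φ x = 0}, ⟨φ, nonneg_on_pos hφ, rfl, ?_⟩,
    fun α hα hαT => ⟨toReal_mem_pos hα, hφT α hα hαT⟩⟩
  rw [span_pos]
  by_contra hne'
  have hlt := hbound _ ⟨φ, hφ, hφT, hφ0, rfl⟩
  obtain ⟨φ', h1', h2', h3', h4'⟩ := exists_supporting_form_of_finrank_lt hS hφ (by omega)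
  have hp' : p _ := ⟨φ', h1', fun α hα hαT => h3' _ (toReal_mem_pos hα) (hφT α hα hαT), h2', rfl⟩
  have := Nat.le_findGreatest (hbound _ hp').le hp'
  omega

/-- A facet is determined by the elements of `S` on it, and there are no inclusions between
different facets. -/
theorem IsFacet.mem_of_forall_mem {F F' : Set (Fin n → ℝ)} (hF : IsFacet (pos S) F)
    (hF' : IsFacet (pos S) F') (h : ∀ α ∈ S, toReal n α ∈ F → toReal n α ∈ F') {α : Fin n → ℤ}
    (hα : α ∈ S) (hαF' : toReal n α ∈ F') : toReal n α ∈ F := by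
  have hle : Submodule.span ℝ F ≤ Submodule.span ℝ F' := by
    rw [Submodule.span_le]
    refine hF.le_span.trans (Submodule.span_mono ?_)
    rintro _ ⟨⟨β, hβ, rfl⟩, hβF⟩
    exact h β hβ hβF
  obtain ⟨φ, -, rfl, h1⟩ := hF
  obtain ⟨φ', -, -, h2⟩ := hF'
  have heq := Submodule.eq_of_le_of_finrank_eq hle (by omega)
  refine ⟨toReal_mem_pos hα, ?_⟩
  have h3 : Submodule.span ℝ {x | x ∈ pos S ∧ φ x = 0} ≤ LinearMap.ker φ :=
    Submodule.span_le.2 fun x hx => hx.2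
  exact h3 (heq ▸ Submodule.subset_span hαF')

theorem facetForm_grp {F : Set (Fin n → ℝ)} (hF : IsFacet (pos S) F) {α : Fin n → ℤ}
    (hα : α ∈ grp (S : Set (Fin n → ℤ))) (h : toReal n α ∈ realSpan S) :
    ∃ k : ℤ, facetForm S F ⟨toReal n α, h⟩ = k := by
  have h1 : facetForm S F ⟨toReal n α, h⟩ ∈ Set.range ((↑) : ℤ → ℝ) := by
    rw [← (isPrimitiveForm_facetForm hF).primitive]
    exact ⟨_, ⟨α, hα, rfl⟩, rfl⟩
  obtain ⟨k, hk⟩ := h1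
  exact ⟨k, hk.symm⟩

/-- The primitive form of a facet takes values in the natural numbers on `S`. -/
theorem exists_degree {F : Set (Fin n → ℝ)} (hF : IsFacet (pos S) F) :
    ∃ d : S →+ ℕ, ∀ β, (d β : ℝ) = facetForm S F (incl S β) := by
  have h : ∀ β : S, ∃ k : ℕ, (k : ℝ) = facetForm S F (incl S β) := by
    intro β
    obtain ⟨k, hk⟩ := facetForm_grp hF (AddSubgroup.subset_closure β.2) (incl S β).2
    have hk' : facetForm S F (incl S β) = k := hk
    have h0 := (isPrimitiveForm_facetForm hF).nonneg (incl S β) (toReal_mem_pos β.2)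
    rw [hk'] at h0
    obtain ⟨m, rfl⟩ := Int.eq_ofNat_of_zero_le (Int.cast_nonneg_iff.1 h0)
    exact ⟨m, by rw [hk']; simp⟩
  choose d hd using h
  have hadd : ∀ a b : S, incl S (a + b) = incl S a + incl S b := fun a b =>
    Subtype.ext (map_add (toReal n) _ _)
  have hzero : incl S 0 = 0 := Subtype.ext (map_zero (toReal n))
  refine ⟨{ toFun := d, map_zero' := ?_, map_add' := fun a b => ?_ }, hd⟩
  · have := hd 0
    rw [hzero, map_zero] at this
    exact_mod_cast this
  · have := hd (a + b)
    rw [hadd, map_add, ← hd, ← hd] at this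
    exact_mod_cast this

theorem degree_eq_zero_iff {F : Set (Fin n → ℝ)} (hF : IsFacet (pos S) F) {d : S →+ ℕ}
    (hd : ∀ β, (d β : ℝ) = facetForm S F (incl S β)) (β : S) :
    d β = 0 ↔ toReal n β ∈ F := by
  rw [← Nat.cast_eq_zero (R := ℝ), hd]
  exact (isPrimitiveForm_facetForm hF).zero_iff (incl S β) (toReal_mem_pos β.2)

/-- The subgroup generated by a submonoid consists of the differences of its elements. -/
theorem exists_sub_of_mem_closure {G : Type*} [AddCommGroup G] (T : AddSubmonoid G) {x : G}
    (hx : x ∈ AddSubgroup.closure (T : Set G)) : ∃ a ∈ T, ∃ b ∈ T, x = a - b := by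
  induction hx using AddSubgroup.closure_induction with
  | mem x hx => exact ⟨x, hx, 0, T.zero_mem, by simp⟩
  | zero => exact ⟨0, T.zero_mem, 0, T.zero_mem, by simp⟩
  | add x y _ _ hx hy =>
    obtain ⟨a, ha, b, hb, rfl⟩ := hx
    obtain ⟨a', ha', b', hb', rfl⟩ := hy
    exact ⟨a + a', T.add_mem ha ha', b + b', T.add_mem hb hb', by abel⟩
  | neg x _ hx =>
    obtain ⟨a, ha, b, hb, rfl⟩ := hx
    exact ⟨b, hb, a, ha, by abel⟩

theorem facetForm_sub {F : Set (Fin n → ℝ)} {d : S →+ ℕ}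
    (hd : ∀ β, (d β : ℝ) = facetForm S F (incl S β)) (a b : S)
    (h : toReal n ((a : Fin n → ℤ) - b) ∈ realSpan S) :
    facetForm S F ⟨toReal n ((a : Fin n → ℤ) - b), h⟩ = d a - d b := by
  rw [hd, hd, ← map_sub]
  congr 1
  exact Subtype.ext (map_sub (toReal n) _ _)

theorem toReal_mem_realSpan {α : Fin n → ℤ} (hα : α ∈ grp (S : Set (Fin n → ℤ))) :
    toReal n α ∈ realSpan S := by
  obtain ⟨a, ha, b, hb, rfl⟩ := exists_sub_of_mem_closure S hα
  rw [map_sub]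
  exact Submodule.sub_mem _ (incl S ⟨a, ha⟩).2 (incl S ⟨b, hb⟩).2

/-- Primitivity of the form of a facet, expressed on `S`. -/
theorem exists_degree_eq_add_one {F : Set (Fin n → ℝ)} (hF : IsFacet (pos S) F) {d : S →+ ℕ}
    (hd : ∀ β, (d β : ℝ) = facetForm S F (incl S β)) : ∃ a b, d a = d b + 1 := by
  have h1 : (1 : ℝ) ∈ Set.range ((↑) : ℤ → ℝ) := ⟨1, by simp⟩
  rw [← (isPrimitiveForm_facetForm hF).primitive] at h1
  obtain ⟨⟨x, hx⟩, ⟨α, hα, hαx⟩, h1⟩ := h1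
  obtain ⟨a, ha, b, hb, rfl⟩ := exists_sub_of_mem_closure S hα
  obtain rfl : _ = x := hαx
  rw [facetForm_sub hd ⟨a, ha⟩ ⟨b, hb⟩] at h1
  refine ⟨⟨a, ha⟩, ⟨b, hb⟩, ?_⟩
  rw [sub_eq_iff_eq_add'] at h1
  exact_mod_cast h1

/-- The two conditions on a facet say that there is an element `β` of positive degree of which all
elements of `S` are multiples up to elements of `S ∩ F`. -/
theorem facet_conditions_iff {F : Set (Fin n → ℝ)} (hF : IsFacet (pos S) F) {d : S →+ ℕ}
    (hd : ∀ β, (d β : ℝ) = facetForm S F (incl S β)) :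
    ((∃ β : S, facetForm S F (incl S β) = 1) ∧
      (grp {α | α ∈ S ∧ toReal n α ∈ F} : Set (Fin n → ℤ)) =
        (grp (S : Set (Fin n → ℤ)) : Set (Fin n → ℤ)) ∩
          {α | toReal n α ∈ facetHyperplane S F}) ↔
    ∃ β, d β ≠ 0 ∧ ∀ γ, ∃ (k : ℕ) (a b : S), d a = 0 ∧ d b = 0 ∧ γ + a = k • β + b := by
  have hd0 := degree_eq_zero_iff hF hd
  let T : AddSubmonoid (Fin n → ℤ) := (AddMonoidHom.mker d).map S.subtype
  have hT : {α | α ∈ S ∧ toReal n α ∈ F} = (T : Set (Fin n → ℤ)) := by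
    ext α
    constructor
    · rintro ⟨hα, hαF⟩
      exact ⟨⟨α, hα⟩, (hd0 ⟨α, hα⟩).2 hαF, rfl⟩
    · rintro ⟨β, hβ, rfl⟩
      exact ⟨β.2, (hd0 β).1 hβ⟩
  have hmem : ∀ {a : S}, d a = 0 → (a : Fin n → ℤ) ∈ AddSubgroup.closure (T : Set (Fin n → ℤ)) :=
    fun {a} ha => AddSubgroup.subset_closure ⟨a, ha, rfl⟩
  have hdiff : ∀ {α : Fin n → ℤ}, α ∈ AddSubgroup.closure (T : Set (Fin n → ℤ)) →
      ∃ a b : S, d a = 0 ∧ d b = 0 ∧ α = a - b := by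
    intro α hα
    obtain ⟨_, ⟨a, ha, rfl⟩, _, ⟨b, hb, rfl⟩, rfl⟩ := exists_sub_of_mem_closure T hα
    exact ⟨a, b, ha, hb, rfl⟩
  have hβ1 : ∀ β, facetForm S F (incl S β) = 1 ↔ d β = 1 := fun β => by
    rw [← hd, Nat.cast_eq_one]
  have hhyp : ∀ a b : S, toReal n ((a : Fin n → ℤ) - b) ∈ facetHyperplane S F ↔ d a = d b := by
    intro a b
    have h : toReal n ((a : Fin n → ℤ) - b) ∈ realSpan S := toReal_mem_realSpan
      (AddSubgroup.sub_mem _ (AddSubgroup.subset_closure a.2) (AddSubgroup.subset_closure b.2))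
    change (∃ h, facetForm S F ⟨_, h⟩ = 0) ↔ _
    rw [exists_prop_of_true h, facetForm_sub hd, sub_eq_zero, Nat.cast_inj]
  simp only [hβ1, hT]
  constructor
  · rintro ⟨⟨β, hβ⟩, hgrp⟩
    refine ⟨β, by omega, fun γ => ?_⟩
    have h1 : (γ : Fin n → ℤ) - (d γ • β : S) ∈ (grp (T : Set (Fin n → ℤ)) : Set _) := by
      rw [hgrp]
      exact ⟨AddSubgroup.sub_mem _ (AddSubgroup.subset_closure γ.2)
        (AddSubgroup.subset_closure (d γ • β).2), (hhyp _ _).2 (by simp [hβ])⟩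
    obtain ⟨b, a, hb, ha, hab⟩ := hdiff h1
    refine ⟨d γ, a, b, ha, hb, Subtype.ext ?_⟩
    rw [sub_eq_sub_iff_add_eq_add] at hab
    rw [AddSubmonoid.coe_add, AddSubmonoid.coe_add, hab, add_comm]
  · rintro ⟨β, hβ, h⟩
    have hk : ∀ {γ : S} {k : ℕ} {a b : S}, d a = 0 → d b = 0 → γ + a = k • β + b →
        d γ = k * d β := by
      intro γ k a b ha hb hab
      have := congrArg d hab
      simpa [ha, hb] using this
    refine ⟨⟨β, ?_⟩, ?_⟩
    · obtain ⟨x, y, hxy⟩ := exists_degree_eq_add_one hF hd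
      obtain ⟨k, a, b, ha, hb, hab⟩ := h x
      obtain ⟨l, a', b', ha', hb', hab'⟩ := h y
      rw [hk ha hb hab, hk ha' hb' hab'] at hxy
      refine Nat.dvd_one.1 ((Nat.dvd_add_right (Dvd.intro_left l rfl)).1 ?_)
      exact hxy ▸ Dvd.intro_left k rfl
    · apply Set.Subset.antisymm
      · intro α hα
        obtain ⟨a, b, ha, hb, rfl⟩ := hdiff hα
        exact ⟨AddSubgroup.sub_mem _ (AddSubgroup.subset_closure a.2)
          (AddSubgroup.subset_closure b.2), (hhyp a b).2 (ha.trans hb.symm)⟩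
      · rintro α ⟨hα, hα0⟩
        obtain ⟨x, hx, y, hy, rfl⟩ := exists_sub_of_mem_closure S hα
        have hxy := (hhyp ⟨x, hx⟩ ⟨y, hy⟩).1 hα0
        obtain ⟨k, a, b, ha, hb, hab⟩ := h ⟨x, hx⟩
        obtain ⟨l, a', b', ha', hb', hab'⟩ := h ⟨y, hy⟩
        rw [hk ha hb hab, hk ha' hb' hab'] at hxy
        obtain rfl := Nat.eq_of_mul_eq_mul_right (Nat.pos_of_ne_zero hβ) hxy
        have e1 : x + a = (k • β : S) + b := congrArg Subtype.val hab
        have e2 : y + a' = (k • β : S) + b' := congrArg Subtype.val hab'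
        have e3 : x - y = ((b : Fin n → ℤ) - a) - (b' - a') := by
          rw [eq_sub_of_add_eq e1, eq_sub_of_add_eq e2]
          abel
        rw [e3]
        exact AddSubgroup.sub_mem _ (AddSubgroup.sub_mem _ (hmem hb) (hmem ha))
          (AddSubgroup.sub_mem _ (hmem hb') (hmem ha'))

end AffineSemigroup

/-! ### Monomial primes of height one and facets -/

namespace AffineSemigroup

variable {n : ℕ} {S : AddSubmonoid (Fin n → ℤ)} {K : Type*} [Field K]

open AddMonoidAlgebra

instance : IsDomain (AddMonoidAlgebra K S) :=
  have : TwoUniqueSums S :=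
    TwoUniqueSums.of_injective_addHom S.subtype.toAddHom Subtype.val_injective inferInstance
  inferInstance

theorem isNoetherianRing_of_fg (hS : S.FG) : IsNoetherianRing (AddMonoidAlgebra K S) :=
  have : AddMonoid.FG S := (AddMonoid.fg_iff_addSubmonoid_fg S).2 hS
  Algebra.FiniteType.isNoetherianRing K _

/-- The exponents of the monomials outside of a prime ideal form a face of `S`. If the prime ideal
contains a monomial, then this face is proper, hence lies on a facet, and the prime ideal contains
the monomials off this facet. -/
theorem exists_isFacet_posDegIdeal_le (hS : S.FG) (P : Ideal (AddMonoidAlgebra K S)) [P.IsPrime]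
    {β : S} (hβ : single β (1 : K) ∈ P) :
    ∃ F, IsFacet (pos S) F ∧ (∀ α : S, single α (1 : K) ∉ P → toReal n α ∈ F) ∧
      ∀ d : S →+ ℕ, (∀ β, (d β : ℝ) = facetForm S F (incl S β)) → posDegIdeal K d ≤ P := by
  let T : AddSubmonoid S :=
    { carrier := {α | single α (1 : K) ∉ P}
      zero_mem' := fun h => Ideal.one_notMem P h
      add_mem' := fun {a b} ha hb h => by
        have h1 : single (a + b) (1 : K) = single a 1 * single b 1 := by
          simp [single_mul_single]
        rw [h1] at h
        exact (Ideal.IsPrime.mem_or_mem ‹_› h).elim ha hb }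
  obtain ⟨F, hF, hTF⟩ := exists_isFacet_of_face hS (T.map S.subtype) (by
    rintro a ha b hb ⟨c, hc, hcab⟩
    refine ⟨⟨a, ha⟩, fun h => hc ?_, rfl⟩
    obtain rfl : c = ⟨a, ha⟩ + ⟨b, hb⟩ := Subtype.ext hcab
    have h1 : single (⟨a, ha⟩ + ⟨b, hb⟩ : S) (1 : K) = single ⟨a, ha⟩ 1 * single ⟨b, hb⟩ 1 := by
      simp [single_mul_single]
    rw [h1]
    exact Ideal.mul_mem_right _ _ h)
    ⟨β, β.2, by
      rintro ⟨c, hc, hcβ⟩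
      obtain rfl : c = β := Subtype.ext hcβ
      exact hc hβ⟩
  have h1 : ∀ α : S, single α (1 : K) ∉ P → toReal n α ∈ F := fun α hα =>
    hTF α α.2 ⟨α, hα, rfl⟩
  refine ⟨F, hF, h1, fun d hd => posDegIdeal_le fun m hm => ?_⟩
  by_contra hmP
  exact hm ((degree_eq_zero_iff hF hd m).2 (h1 m hmP))

/-- The prime ideal of a facet has height at most one by Krull's principal ideal theorem: it is
minimal over any monomial it contains, as there are no inclusions between different facets. -/
theorem height_posDegIdeal_le_one (hS : S.FG) {F : Set (Fin n → ℝ)} (hF : IsFacet (pos S) F)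
    {d : S →+ ℕ} (hd : ∀ β, (d β : ℝ) = facetForm S F (incl S β)) :
    (posDegIdeal K d).height ≤ 1 := by
  have := isNoetherianRing_of_fg (K := K) hS
  obtain ⟨a, b, hab⟩ := exists_degree_eq_add_one hF hd
  have ha : d a ≠ 0 := by omega
  refine Ideal.height_le_one_of_isPrincipal_of_mem_minimalPrimes
    (Ideal.span {single a (1 : K)}) _ ⟨⟨inferInstance, ?_⟩, ?_⟩
  · rw [Ideal.span_singleton_le_iff_mem]
    exact single_mem_posDegIdeal.2 ha
  · rintro Q ⟨hQ, haQ⟩ hQP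
    rw [Ideal.span_singleton_le_iff_mem] at haQ
    obtain ⟨F', hF', hQF', hle⟩ := exists_isFacet_posDegIdeal_le hS Q haQ
    obtain ⟨d', hd'⟩ := exists_degree hF'
    refine le_trans (posDegIdeal_le fun m hm => single_mem_posDegIdeal.2 fun hm' => hm ?_)
      (hle d' hd')
    rw [degree_eq_zero_iff hF' hd'] at hm'
    rw [degree_eq_zero_iff hF hd]
    refine hF.mem_of_forall_mem hF' (fun α hα hαF => hQF' ⟨α, hα⟩ fun h => ?_) m.2 hm'
    exact single_mem_posDegIdeal.1 (hQP h) ((degree_eq_zero_iff hF hd ⟨α, hα⟩).2 hαF)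

theorem posDegIdeal_ne_bot {d : S →+ ℕ} (hd : d ≠ 0) : posDegIdeal K d ≠ ⊥ := by
  intro h
  refine hd (AddMonoidHom.ext fun m => ?_)
  by_contra hm
  have := single_mem_posDegIdeal (K := K).2 hm
  rw [h] at this
  simp at this

/-- The primes of height at most one that contain a monomial are the primes of the facets. -/
theorem exists_eq_posDegIdeal (hS : S.FG) (P : Ideal (AddMonoidAlgebra K S)) [P.IsPrime]
    (hP : P.height ≤ 1) {β : S} (hβ : single β (1 : K) ∈ P) :
    ∃ F, ∃ d : S →+ ℕ, IsFacet (pos S) F ∧ (∀ β, (d β : ℝ) = facetForm S F (incl S β)) ∧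
      P = posDegIdeal K d := by
  obtain ⟨F, hF, -, hle⟩ := exists_isFacet_posDegIdeal_le hS P hβ
  obtain ⟨d, hd⟩ := exists_degree hF
  refine ⟨F, d, hF, hd, ?_⟩
  obtain ⟨a, b, hab⟩ := exists_degree_eq_add_one hF hd
  have hd0 : d ≠ 0 := by
    rintro rfl
    simp at hab
  by_contra hne
  have hlt := lt_of_le_of_ne (hle d hd) (Ne.symm hne)
  have h1 : (posDegIdeal K d).height < P.height :=
    have : P.FiniteHeight := P.finiteHeight_iff.2 (.inr (hP.trans_lt (by simp)).ne)
    Ideal.height_strict_mono_of_isPrime_of_isPrime hlt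
  have h2 : (posDegIdeal K d).height = 0 := by
    rw [← Order.lt_one_iff]
    exact h1.trans_le hP
  exact posDegIdeal_ne_bot hd0 (Ideal.height_eq_zero_iff_eq_bot.1 h2)

/-- The characterization of `R_1` for the monoid ring of a submonoid of `ℤⁿ`, without passing to an
isomorphic monoid. -/
theorem satisfiesSerreR_one_iff (hS : S.FG) :
    SatisfiesSerreR 1 (AddMonoidAlgebra K S) ↔
      ∀ F : Set (Fin n → ℝ), IsFacet (pos S) F →
        (∃ β : S, facetForm S F (incl S β) = 1) ∧
        (grp {α | α ∈ S ∧ toReal n α ∈ F} : Set (Fin n → ℤ)) =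
          (grp (S : Set (Fin n → ℤ)) : Set (Fin n → ℤ)) ∩
            {α | toReal n α ∈ facetHyperplane S F} := by
  have := isNoetherianRing_of_fg (K := K) hS
  constructor
  · intro h F hF
    obtain ⟨d, hd⟩ := exists_degree hF
    obtain ⟨a, b, hab⟩ := exists_degree_eq_add_one hF hd
    have hd0 : d ≠ 0 := by
      rintro rfl
      simp at hab
    have hht := height_posDegIdeal_le_one (K := K) hS hF hd
    exact (facet_conditions_iff hF hd).2
      (exists_of_isRegularLocalRing_posDegIdeal hd0 hht (h _ hht))
  · intro h P _ hP
    by_cases hmon : ∃ β : S, single β (1 : K) ∈ P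
    · obtain ⟨β, hβ⟩ := hmon
      obtain ⟨F, d, hF, hd, rfl⟩ := exists_eq_posDegIdeal hS P hP hβ
      obtain ⟨β, hβ0, hβ⟩ := (facet_conditions_iff hF hd).1 (h F hF)
      exact isRegularLocalRing_posDegIdeal hβ0 hβ
    · push Not at hmon
      let G := AddSubgroup.toIntSubmodule (grp (S : Set (Fin n → ℤ)))
      let f : S →+ G :=
        { toFun := fun s => ⟨s, AddSubgroup.subset_closure s.2⟩
          map_zero' := rfl
          map_add' := fun _ _ => rfl }
      refine isRegularLocalRing_of_forall_single_notMem f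
        (fun a b hab => Subtype.ext (congrArg (fun x : G => (x : Fin n → ℤ)) hab)) ?_ P hP hmon
      rintro ⟨g, hg⟩
      obtain ⟨a, ha, b, hb, rfl⟩ := exists_sub_of_mem_closure S hg
      exact ⟨⟨a, ha⟩, ⟨b, hb⟩, rfl⟩

end AffineSemigroup

open AffineSemigroup in
theorem mainTheorem2 {K : Type*} [Field K] {n : ℕ} (S : AddSubmonoid (Fin n → ℤ)) (hS : S.FG)
    {M : Type*} [AddCommMonoid M] (e : M ≃+ S) :
    SatisfiesSerreR 1 (AddMonoidAlgebra K M) ↔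
      ∀ F : Set (Fin n → ℝ), IsFacet (pos S) F →
        (∃ β : S, facetForm S F (incl S β) = 1) ∧
        (grp {α | α ∈ S ∧ toReal n α ∈ F} : Set (Fin n → ℤ)) =
          (grp (S : Set (Fin n → ℤ)) : Set (Fin n → ℤ)) ∩
            {α | toReal n α ∈ facetHyperplane S F} := by
  rw [← satisfiesSerreR_one_iff (K := K) hS]
  have E : AddMonoidAlgebra K M ≃+* AddMonoidAlgebra K S :=
    (AddMonoidAlgebra.domCongr K K e).toRingEquiv
  exact ⟨SatisfiesSerreR.of_ringEquiv E, SatisfiesSerreR.of_ringEquiv E.symm⟩
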